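/- **Theorem 4.5 ($H^1$ estimate for the multiplicative space $V_h^*$).** Let $d\in\mathbb N$ and let $\alpha,\beta,C_I>0$. There is a constant $C>0$, depending only on $d,\alpha,\beta,C_I$, such that the following holds. Let $\Omega\subset\mathbb R^d$ be a bounded open set, let $V$ be $H^1_0(\Omega)$ or $H^1(\Omega)$ (real-valued functions, with the norm of $H^1(\Omega)$), let $B$ be a bilinear form on $V$ with $$|B(v,w)|\le\alpha\|v\|_{H^1(\Omega)}\|w\|_{H^1(\Omega)},\qquad \beta\|v\|_{H^1(\Omega)}^2\le|B(v,v)|\qquad(v,w\in V),$$ let $F$ be a continuous linear functional on $V$, and let $u\in V$ satisfy $B(u,v)=F(v)$ for all $v\in V$. Let $m\ge1$ be an integer, $h>0$, let $V_h\subset V$ be a finite-dimensional subspace, and let $\mathcal I_h:V\cap H^m(\Omega)\to V_h$ be an interpolation operator with approximation order $m$, that is, $$\|v-\mathcal I_hv\|_{H^1(\Omega)}\le C_I\,h^{m-1}|v|_{H^m(\Omega)}\qquad\text{for all }v\in V\cap H^m(\Omega).$$ Let $u_\theta$ be a real-valued function that is $C^\infty$ on an open set containing $\overline\Omega$ and has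 no zero in $\overline\Omega$, and let $V_h^*=\{w\,u_\theta: w\in V_h\}$. Then $V_h^*\subset V$; there is exactly one $u_h^*\in V_h^*$ with $$B(u_h^*,v)=F(v)\qquad\text{for all }v\in V_h^*;$$ and, if $u/u_\theta\in H^m(\Omega)$, then $$\|u-u_h^*\|_{H^1(\Omega)}\le C\,h^{m-1}\,\|u_\theta\|_{C^1(\Omega)}\,\Big|\frac{u}{u_\theta}\Big|_{H^m(\Omega)} .$$ Here $|v|_{H^m(\Omega)}^2=\sum_{|\gamma|=m}\|D^\gamma v\|_{L^2(\Omega)}^2$ and $\|v\|_{H^1(\Omega)}^2=\sum_{|\gamma|\le1}\|D^\gamma v\|_{L^2(\Omega)}^2$ with weak derivatives, and $\|w\|_{C^1(\Omega)}=\max_{|\gamma|\le1}\sup_{\Omega}|D^\gamma w|$. -/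

import Mathlib

open MeasureTheory TopologicalSpace
open scoped ContDiff

namespace EnrichedFEM

/-- The partial derivative `∂ᵢ f` of a function on `ℝᵈ`. -/
noncomputable def pderiv {d : ℕ} (i : Fin d) (f : EuclideanSpace ℝ (Fin d) → ℝ) :
    EuclideanSpace ℝ (Fin d) → ℝ :=
  fun x => fderiv ℝ f x (EuclideanSpace.single i 1)

/-- The classical mixed derivative `∂₀^{α₀} ∂₁^{α₁} ⋯ f` for a multi-index `α`. -/
noncomputable def mderiv {d : ℕ} (α : Fin d → ℕ) (f : EuclideanSpace ℝ (Fin d) → ℝ) :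
    EuclideanSpace ℝ (Fin d) → ℝ :=
  (List.finRange d).foldr (fun i g => (pderiv i)^[α i] g) f

/-- Test functions on `Ω`: the elements of `C_c^∞(Ω)`, extended by zero to `ℝᵈ`. -/
structure IsTest {d : ℕ} (Ω : Opens (EuclideanSpace ℝ (Fin d)))
    (φ : EuclideanSpace ℝ (Fin d) → ℝ) : Prop where
  smooth : ContDiff ℝ ∞ φ
  compact : HasCompactSupport φ
  supp : tsupport φ ⊆ (Ω : Set (EuclideanSpace ℝ (Fin d)))

/-- The real Hilbert space `L²(Ω)`, with Lebesgue measure. -/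
abbrev L2 {d : ℕ} (Ω : Opens (EuclideanSpace ℝ (Fin d))) : Type :=
  Lp ℝ 2 (volume.restrict (Ω : Set (EuclideanSpace ℝ (Fin d))))

/-- `g ∈ L²(Ω)` is the weak derivative `D^α u` of `u ∈ L²(Ω)`. -/
def HasWeakDeriv {d : ℕ} {Ω : Opens (EuclideanSpace ℝ (Fin d))} (α : Fin d → ℕ)
    (u g : L2 Ω) : Prop :=
  ∀ φ : EuclideanSpace ℝ (Fin d) → ℝ, IsTest Ω φ →
    ∫ x in (Ω : Set (EuclideanSpace ℝ (Fin d))), u x * mderiv α φ x =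
      (-1) ^ (∑ i, α i) * ∫ x in (Ω : Set (EuclideanSpace ℝ (Fin d))), g x * φ x

section helpers

variable {d : ℕ} {Ω : Opens (EuclideanSpace ℝ (Fin d))}

theorem pderiv_smooth (i : Fin d) {f : EuclideanSpace ℝ (Fin d) → ℝ} (hf : ContDiff ℝ ∞ f) :
    ContDiff ℝ ∞ (pderiv i f) :=
  (hf.fderiv_right (m := ∞) (by simp)).clm_apply contDiff_const

theorem IsTest.pderiv {φ : EuclideanSpace ℝ (Fin d) → ℝ} (h : IsTest Ω φ) (i : Fin d) :
    IsTest Ω (pderiv i φ) := by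
  have hs : tsupport (EnrichedFEM.pderiv i φ) ⊆ tsupport φ :=
    tsupport_fderiv_apply_subset ℝ _
  exact ⟨pderiv_smooth i h.smooth, h.compact.fderiv_apply ℝ _, hs.trans h.supp⟩

theorem IsTest.mderiv {φ : EuclideanSpace ℝ (Fin d) → ℝ} (h : IsTest Ω φ) (α : Fin d → ℕ) :
    IsTest Ω (mderiv α φ) := by
  have key : ∀ l : List (Fin d),
      IsTest Ω (l.foldr (fun i g => (EnrichedFEM.pderiv i)^[α i] g) φ) := by
    intro l
    induction l with
    | nil => exact h
    | cons i l ih =>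
      rw [List.foldr_cons]
      generalize l.foldr (fun i g => (EnrichedFEM.pderiv i)^[α i] g) φ = g at ih
      induction α i with
      | zero => exact ih
      | succ n ihn =>
        rw [Function.iterate_succ_apply']
        exact ihn.pderiv i
  exact key _

theorem IsTest.memLp {φ : EuclideanSpace ℝ (Fin d) → ℝ} (h : IsTest Ω φ) :
    MemLp φ 2 (volume.restrict (Ω : Set (EuclideanSpace ℝ (Fin d)))) :=
  (h.smooth.continuous.memLp_of_hasCompactSupport h.compact).restrict _

theorem IsTest.integrable_mul {φ : EuclideanSpace ℝ (Fin d) → ℝ} (h : IsTest Ω φ) (u : L2 Ω) :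
    IntegrableOn (fun x => u x * φ x) (Ω : Set (EuclideanSpace ℝ (Fin d))) :=
  (Lp.memLp u).integrable_mul h.memLp

theorem IsTest.add {φ ψ : EuclideanSpace ℝ (Fin d) → ℝ} (hφ : IsTest Ω φ) (hψ : IsTest Ω ψ) :
    IsTest Ω (φ + ψ) :=
  ⟨hφ.smooth.add hψ.smooth, hφ.compact.add hψ.compact,
    (tsupport_add φ ψ).trans (Set.union_subset hφ.supp hψ.supp)⟩

theorem IsTest.smul {φ : EuclideanSpace ℝ (Fin d) → ℝ} (hφ : IsTest Ω φ) (c : ℝ) :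
    IsTest Ω (c • φ) :=
  ⟨hφ.smooth.const_smul c, hφ.compact.smul_left (f := fun _ => c),
    (tsupport_smul_subset_right (fun _ => c) φ).trans hφ.supp⟩

theorem isTest_zero : IsTest Ω 0 :=
  ⟨contDiff_const, HasCompactSupport.zero, by simp [tsupport]⟩

/-- Weak derivatives are unique. -/
theorem HasWeakDeriv.unique {α : Fin d → ℕ} {u g g' : L2 Ω} (h : HasWeakDeriv α u g)
    (h' : HasWeakDeriv α u g') : g = g' := by
  have hint : ∀ φ, IsTest Ω φ → ∫ x in (Ω : Set (EuclideanSpace ℝ (Fin d))), g x * φ x =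
      ∫ x in (Ω : Set (EuclideanSpace ℝ (Fin d))), g' x * φ x := by
    intro φ hφ
    exact mul_left_cancel₀ (pow_ne_zero _ (by norm_num)) ((h φ hφ).symm.trans (h' φ hφ))
  have hloc : LocallyIntegrableOn (fun x => g x - g' x)
      (Ω : Set (EuclideanSpace ℝ (Fin d))) (volume.restrict Ω) :=
    (((Lp.memLp g).sub (Lp.memLp g')).locallyIntegrable (by norm_num)).locallyIntegrableOn _
  have h0 := Ω.isOpen.ae_eq_zero_of_integral_contDiff_smul_eq_zero hloc (by
    intro φ h1 h2 h3
    have hφ : IsTest Ω φ := ⟨h1, h2, h3⟩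
    have : ∀ x, φ x • (g x - g' x) = g x * φ x - g' x * φ x := fun x => by
      rw [smul_eq_mul]; ring
    simp_rw [this]
    rw [integral_sub (hφ.integrable_mul g) (hφ.integrable_mul g'), hint φ hφ, sub_self])
  refine Lp.ext ?_
  filter_upwards [h0, ae_restrict_mem Ω.isOpen.measurableSet] with x hx hxΩ
  exact sub_eq_zero.1 (hx hxΩ)

theorem HasWeakDeriv.add {α : Fin d → ℕ} {u v g g' : L2 Ω} (h : HasWeakDeriv α u g)
    (h' : HasWeakDeriv α v g') : HasWeakDeriv α (u + v) (g + g') := by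
  have key : ∀ (a b : L2 Ω) (ψ), IsTest Ω ψ →
      ∫ x in (Ω : Set (EuclideanSpace ℝ (Fin d))), (a + b : L2 Ω) x * ψ x =
        (∫ x in (Ω : Set (EuclideanSpace ℝ (Fin d))), a x * ψ x) +
          ∫ x in (Ω : Set (EuclideanSpace ℝ (Fin d))), b x * ψ x := by
    intro a b ψ hψ
    rw [← integral_add (hψ.integrable_mul a) (hψ.integrable_mul b)]
    refine integral_congr_ae ?_
    filter_upwards [Lp.coeFn_add a b] with x hx
    rw [hx, Pi.add_apply, add_mul]
  intro φ hφ
  rw [key u v _ (hφ.mderiv α), key g g' _ hφ, h φ hφ, h' φ hφ, mul_add]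

theorem HasWeakDeriv.smul {α : Fin d → ℕ} {u g : L2 Ω} (h : HasWeakDeriv α u g) (c : ℝ) :
    HasWeakDeriv α (c • u) (c • g) := by
  have key : ∀ (a : L2 Ω) (ψ : EuclideanSpace ℝ (Fin d) → ℝ),
      ∫ x in (Ω : Set (EuclideanSpace ℝ (Fin d))), (c • a : L2 Ω) x * ψ x =
        c * ∫ x in (Ω : Set (EuclideanSpace ℝ (Fin d))), a x * ψ x := by
    intro a ψ
    rw [← integral_const_mul]
    refine integral_congr_ae ?_
    filter_upwards [Lp.coeFn_smul c a] with x hx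
    rw [hx, Pi.smul_apply, smul_eq_mul, mul_assoc]
  intro φ hφ
  rw [key, key, h φ hφ]
  ring

theorem hasWeakDeriv_zero (α : Fin d → ℕ) : HasWeakDeriv α (0 : L2 Ω) 0 := by
  have key : ∀ ψ : EuclideanSpace ℝ (Fin d) → ℝ,
      ∫ x in (Ω : Set (EuclideanSpace ℝ (Fin d))), (0 : L2 Ω) x * ψ x = 0 := by
    intro ψ
    rw [← integral_zero (EuclideanSpace ℝ (Fin d)) ℝ]
    refine integral_congr_ae ?_
    filter_upwards [Lp.coeFn_zero ℝ 2
      (volume.restrict (Ω : Set (EuclideanSpace ℝ (Fin d))))] with x hx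
    rw [hx, Pi.zero_apply, zero_mul]
  intro φ _
  rw [key, key, mul_zero]

end helpers

/-- The Sobolev space `H^k(Ω)`, as a subspace of `L²(Ω)`. -/
def sobolev {d : ℕ} (Ω : Opens (EuclideanSpace ℝ (Fin d))) (k : ℕ) : Submodule ℝ (L2 Ω) where
  carrier := {u | ∀ α : Fin d → ℕ, ∑ i, α i ≤ k → ∃ g : L2 Ω, HasWeakDeriv α u g}
  add_mem' := fun hu hv α hα => by
    obtain ⟨g, hg⟩ := hu α hα
    obtain ⟨g', hg'⟩ := hv α hα
    exact ⟨g + g', hg.add hg'⟩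
  zero_mem' := fun α _ => ⟨0, hasWeakDeriv_zero α⟩
  smul_mem' := fun c _ hu α hα => by
    obtain ⟨g, hg⟩ := hu α hα
    exact ⟨c • g, hg.smul c⟩

open Classical in
/-- The weak derivative `D^α u` in `L²(Ω)`; it is unique, and set to `0` if there is none. -/
noncomputable def weakDeriv {d : ℕ} {Ω : Opens (EuclideanSpace ℝ (Fin d))} (α : Fin d → ℕ)
    (u : L2 Ω) : L2 Ω :=
  if h : ∃ g : L2 Ω, HasWeakDeriv α u g then h.choose else 0

/-- The seminorm `|u|_{H^k(Ω)} = (∑_{|α| = k} ‖D^α u‖²_{L²})^{1/2}`, for `u ∈ H^k(Ω)`. -/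
noncomputable def sobolevSeminorm {d : ℕ} {Ω : Opens (EuclideanSpace ℝ (Fin d))} (k : ℕ)
    (u : L2 Ω) : ℝ :=
  √(∑ α ∈ Finset.univ.piAntidiag k, ‖weakDeriv α u‖ ^ 2)

/-- The norm `‖u‖_{H^k(Ω)} = (∑_{|α| ≤ k} ‖D^α u‖²_{L²})^{1/2}`, for `u ∈ H^k(Ω)`. -/
noncomputable def sobolevNorm {d : ℕ} {Ω : Opens (EuclideanSpace ℝ (Fin d))} (k : ℕ)
    (u : L2 Ω) : ℝ :=
  √(∑ j ∈ Finset.range (k + 1), ∑ α ∈ Finset.univ.piAntidiag j, ‖weakDeriv α u‖ ^ 2)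

section helpers

variable {d : ℕ} {Ω : Opens (EuclideanSpace ℝ (Fin d))}

theorem HasWeakDeriv.weakDeriv_eq {α : Fin d → ℕ} {u g : L2 Ω} (h : HasWeakDeriv α u g) :
    weakDeriv α u = g := by
  have h' : ∃ g : L2 Ω, HasWeakDeriv α u g := ⟨g, h⟩
  rw [weakDeriv, dif_pos h']
  exact h'.choose_spec.unique h

theorem weakDeriv_add {k : ℕ} {u v : L2 Ω} (hu : u ∈ sobolev Ω k) (hv : v ∈ sobolev Ω k)
    {α : Fin d → ℕ} (hα : ∑ i, α i ≤ k) :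
    weakDeriv α (u + v) = weakDeriv α u + weakDeriv α v := by
  obtain ⟨g, hg⟩ := hu α hα
  obtain ⟨g', hg'⟩ := hv α hα
  rw [hg.weakDeriv_eq, hg'.weakDeriv_eq, (hg.add hg').weakDeriv_eq]

theorem weakDeriv_smul {k : ℕ} {u : L2 Ω} (hu : u ∈ sobolev Ω k) (c : ℝ)
    {α : Fin d → ℕ} (hα : ∑ i, α i ≤ k) : weakDeriv α (c • u) = c • weakDeriv α u := by
  obtain ⟨g, hg⟩ := hu α hα
  rw [hg.weakDeriv_eq, (hg.smul c).weakDeriv_eq]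

theorem sobolevNorm_eq_sigma (k : ℕ) (u : L2 Ω) :
    sobolevNorm k u = √(∑ p ∈ (Finset.range (k + 1)).sigma
      (fun j => (Finset.univ : Finset (Fin d)).piAntidiag j), ‖weakDeriv p.2 u‖ ^ 2) := by
  rw [sobolevNorm, Finset.sum_sigma]

theorem sobolevNorm_add_le {k : ℕ} {u v : L2 Ω} (hu : u ∈ sobolev Ω k) (hv : v ∈ sobolev Ω k) :
    sobolevNorm k (u + v) ≤ sobolevNorm k u + sobolevNorm k v := by
  simp only [sobolevNorm_eq_sigma]
  set S := (Finset.range (k + 1)).sigma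
      (fun j => (Finset.univ : Finset (Fin d)).piAntidiag j) with hS
  have h1 : ∑ p ∈ S, ‖weakDeriv p.2 (u + v)‖ ^ 2 ≤
      ∑ p ∈ S, (‖weakDeriv p.2 u‖ + ‖weakDeriv p.2 v‖) ^ 2 := by
    refine Finset.sum_le_sum fun p hp => ?_
    have hp' : ∑ i, p.2 i ≤ k := by
      rw [hS, Finset.mem_sigma, Finset.mem_range, Finset.mem_piAntidiag] at hp
      exact hp.2.1.trans_le (Nat.lt_succ_iff.1 hp.1)
    rw [weakDeriv_add hu hv hp']
    gcongr
    exact norm_add_le _ _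
  refine (Real.sqrt_le_sqrt h1).trans ?_
  have := Real.Lp_add_le_of_nonneg (p := 2) S (f := fun p => ‖weakDeriv p.2 u‖)
    (g := fun p => ‖weakDeriv p.2 v‖) (by norm_num) (fun _ _ => norm_nonneg _)
    (fun _ _ => norm_nonneg _)
  simpa only [Real.sqrt_eq_rpow, Real.rpow_two] using this

theorem sobolevNorm_smul {k : ℕ} {u : L2 Ω} (hu : u ∈ sobolev Ω k) (c : ℝ) :
    sobolevNorm k (c • u) = |c| * sobolevNorm k u := by
  simp only [sobolevNorm_eq_sigma]
  nth_rw 1 [← Real.sqrt_sq (abs_nonneg c)]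
  rw [← Real.sqrt_mul (sq_nonneg _), Finset.mul_sum]
  congr 1
  refine Finset.sum_congr rfl fun p hp => ?_
  have hp' : ∑ i, p.2 i ≤ k := by
    rw [Finset.mem_sigma, Finset.mem_range, Finset.mem_piAntidiag] at hp
    exact hp.2.1.trans_le (Nat.lt_succ_iff.1 hp.1)
  rw [weakDeriv_smul hu c hp', norm_smul, mul_pow, Real.norm_eq_abs]

end helpers

/-- `H^1_0(Ω)`: the closure of `C_c^∞(Ω)` in `H^1(Ω)`; `p` is the class of the test
function `φ`. -/
def sobolevZero {d : ℕ} (Ω : Opens (EuclideanSpace ℝ (Fin d))) : Submodule ℝ (L2 Ω) where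
  carrier := {u | u ∈ sobolev Ω 1 ∧ ∀ ε : ℝ, 0 < ε →
    ∃ φ : EuclideanSpace ℝ (Fin d) → ℝ, IsTest Ω φ ∧
      ∃ p ∈ sobolev Ω 1, (p =ᵐ[volume.restrict (Ω : Set (EuclideanSpace ℝ (Fin d)))] φ) ∧
        sobolevNorm 1 (u - p) < ε}
  add_mem' := by
    rintro u v ⟨hu, hu'⟩ ⟨hv, hv'⟩
    refine ⟨add_mem hu hv, fun ε hε => ?_⟩
    obtain ⟨φ, hφ, p, hp, hpφ, hpu⟩ := hu' (ε / 2) (by positivity)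
    obtain ⟨ψ, hψ, q, hq, hqψ, hqv⟩ := hv' (ε / 2) (by positivity)
    refine ⟨φ + ψ, hφ.add hψ, p + q, add_mem hp hq, ?_, ?_⟩
    · exact (Lp.coeFn_add p q).trans (hpφ.add hqψ)
    · rw [add_sub_add_comm]
      have := sobolevNorm_add_le (sub_mem hu hp) (sub_mem hv hq)
      linarith
  zero_mem' := by
    refine ⟨zero_mem _, fun ε hε => ⟨0, isTest_zero, 0, zero_mem _, Lp.coeFn_zero _ _ _, ?_⟩⟩
    have := sobolevNorm_smul (zero_mem (sobolev Ω 1)) 0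
    rw [smul_zero, abs_zero, zero_mul] at this
    rwa [sub_zero, this]
  smul_mem' := by
    rintro c u ⟨hu, hu'⟩
    refine ⟨Submodule.smul_mem _ c hu, fun ε hε => ?_⟩
    obtain ⟨φ, hφ, p, hp, hpφ, hpu⟩ := hu' (ε / (|c| + 1)) (by positivity)
    refine ⟨c • φ, hφ.smul c, c • p, Submodule.smul_mem _ c hp, ?_, ?_⟩
    · exact (Lp.coeFn_smul c p).trans (hpφ.const_smul c)
    · rw [← smul_sub, sobolevNorm_smul (sub_mem hu hp)]
      have h1 : 0 < |c| + 1 := by positivity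
      rw [lt_div_iff₀ h1] at hpu
      have h2 : 0 ≤ sobolevNorm 1 (u - p) := Real.sqrt_nonneg _
      nlinarith

/-- The multiplicative space `V_h^* = V_h · w`: all products `v · w` with `v ∈ V_h`
that lie in `L²(Ω)` (for bounded `w` these are all the products). -/
def mulSpace {d : ℕ} {Ω : Opens (EuclideanSpace ℝ (Fin d))} (Vh : Submodule ℝ (L2 Ω))
    (w : EuclideanSpace ℝ (Fin d) → ℝ) : Submodule ℝ (L2 Ω) where
  carrier := {z | ∃ v ∈ Vh,
    z =ᵐ[volume.restrict (Ω : Set (EuclideanSpace ℝ (Fin d)))] fun x => v x * w x}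
  add_mem' := by
    rintro y z ⟨v, hv, hy⟩ ⟨v', hv', hz⟩
    refine ⟨v + v', add_mem hv hv', ?_⟩
    filter_upwards [hy, hz, Lp.coeFn_add y z, Lp.coeFn_add v v'] with x h1 h2 h3 h4
    rw [h3, h4, Pi.add_apply, Pi.add_apply, h1, h2, add_mul]
  zero_mem' := by
    refine ⟨0, zero_mem _, ?_⟩
    filter_upwards [Lp.coeFn_zero ℝ 2
      (volume.restrict (Ω : Set (EuclideanSpace ℝ (Fin d))))] with x hx
    rw [hx, Pi.zero_apply, zero_mul]
  smul_mem' := by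
    rintro c z ⟨v, hv, hz⟩
    refine ⟨c • v, Submodule.smul_mem _ c hv, ?_⟩
    filter_upwards [hz, Lp.coeFn_smul c z, Lp.coeFn_smul c v] with x h1 h2 h3
    rw [h2, h3, Pi.smul_apply, Pi.smul_apply, h1, smul_eq_mul, smul_eq_mul, mul_assoc]

/-- The norm of `C^1` on `Ω`, `max_{|α| ≤ 1} sup_Ω |D^α w|`, for `w` with bounded derivatives of
order at most one. -/
noncomputable def c1Norm {d : ℕ} (Ω : Opens (EuclideanSpace ℝ (Fin d)))
    (w : EuclideanSpace ℝ (Fin d) → ℝ) : ℝ :=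
  max (⨆ x : Ω, |w x|) (⨆ i : Fin d, ⨆ x : Ω, |pderiv i w x|)

/-- `z` is a Galerkin solution in the subspace `W`: `z ∈ W` and `B(z, v) = F(v)` for all
`v ∈ W`. -/
def IsGalerkinSolution {d : ℕ} {Ω : Opens (EuclideanSpace ℝ (Fin d))} {V : Submodule ℝ (L2 Ω)}
    (B : V →ₗ[ℝ] V →ₗ[ℝ] ℝ) (F : V →ₗ[ℝ] ℝ) (W : Submodule ℝ (L2 Ω)) (z : V) : Prop :=
  (z : L2 Ω) ∈ W ∧ ∀ v : V, (v : L2 Ω) ∈ W → B z v = F v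

end EnrichedFEM

/-! The space $V_h^*$ is $V_h$ transported by multiplication with $u_\theta$, so approximating $u$
in $V_h^*$ amounts to approximating $q=u/u_\theta$ in $V_h$: with $v=(\mathcal I_hq)u_\theta$ one
has $u-v=(q-\mathcal I_hq)u_\theta$. Three bounds combine. Céa's lemma
(`IsGalerkinSolution.sobolevNorm_sub_le`) contributes $\alpha/\beta$. The multiplier estimate
$\|wg\|_{H^1}\le\sqrt{2d+2}\,\|g\|_{C^1}\|w\|_{H^1}$ (`mul_smooth_mem_sobolev_one`) removes the
factor $u_\theta$. The interpolation property contributes $C_Ih^{m-1}|q|_{H^m}$.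

Multiplication by functions smooth up to the boundary preserves $V$ (`mul_smooth_mem`). With
$u_\theta$ this gives $V_h^*\subset V$; with $1/u_\theta$ it gives $q\in V$, so that $\mathcal I_hq$
is defined. Unique solvability is linear algebra: coercivity makes the restricted form injective,
hence bijective in finite dimension. -/

namespace EnrichedFEM

section multiplication

variable {d : ℕ} {Ω : Opens (EuclideanSpace ℝ (Fin d))}

/-! ### Multi-indices of order at most one -/

theorem exists_eq_single_of_sum_eq_one {γ : Fin d → ℕ} (h : ∑ i, γ i = 1) :
    ∃ i, γ = Pi.single i 1 := by
  obtain ⟨i, -, hi⟩ := Finset.exists_ne_zero_of_sum_ne_zero (h.trans_ne one_ne_zero)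
  have h1 := Finset.add_sum_erase Finset.univ γ (Finset.mem_univ i)
  rw [h] at h1
  have h0 : ∑ j ∈ Finset.univ.erase i, γ j = 0 := by omega
  refine ⟨i, funext fun j => ?_⟩
  by_cases hj : j = i
  · subst hj
    rw [Pi.single_eq_same]
    omega
  · rw [Pi.single_eq_of_ne hj]
    exact Finset.sum_eq_zero_iff.1 h0 j (Finset.mem_erase.2 ⟨hj, Finset.mem_univ j⟩)

theorem sum_single_one (i : Fin d) : ∑ j, (Pi.single i 1 : Fin d → ℕ) j = 1 := by simp

theorem piAntidiag_univ_one :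
    (Finset.univ : Finset (Fin d)).piAntidiag 1 =
      Finset.univ.image fun i => (Pi.single i 1 : Fin d → ℕ) := by
  ext γ
  simp only [Finset.mem_piAntidiag, Finset.mem_image, Finset.mem_univ, true_and, implies_true,
    and_true]
  constructor
  · intro h
    obtain ⟨i, hi⟩ := exists_eq_single_of_sum_eq_one h
    exact ⟨i, hi.symm⟩
  · rintro ⟨i, rfl⟩
    exact sum_single_one i

theorem mderiv_zero (f : EuclideanSpace ℝ (Fin d) → ℝ) : mderiv 0 f = f := by
  have key : ∀ l : List (Fin d),
      l.foldr (fun i g => (pderiv i)^[(0 : Fin d → ℕ) i] g) f = f := by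
    intro l
    induction l with
    | nil => rfl
    | cons j l ih => rw [List.foldr_cons, ih]; rfl
  exact key _

theorem mderiv_single (i : Fin d) (f : EuclideanSpace ℝ (Fin d) → ℝ) :
    mderiv (Pi.single i 1) f = pderiv i f := by
  -- Without repetitions in the list, `pderiv i` is applied at most once.
  have key : ∀ l : List (Fin d), l.Nodup →
      l.foldr (fun j g => (pderiv j)^[(Pi.single i 1 : Fin d → ℕ) j] g) f =
        if i ∈ l then pderiv i f else f := by
    intro l
    induction l with
    | nil => intro _; simp
    | cons j l ih =>
      intro hl
      rw [List.nodup_cons] at hl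
      rw [List.foldr_cons, ih hl.2]
      by_cases hj : j = i
      · subst hj
        simp [hl.1]
      · simp [Ne.symm hj]
  rw [mderiv, key _ (List.nodup_finRange d), if_pos (List.mem_finRange i)]

theorem hasWeakDeriv_self (u : L2 Ω) : HasWeakDeriv 0 u u := by
  intro φ _
  simp [mderiv_zero]

theorem weakDeriv_zero_index (u : L2 Ω) : weakDeriv 0 u = u :=
  (hasWeakDeriv_self u).weakDeriv_eq

theorem mem_sobolev_one {u : L2 Ω} :
    u ∈ sobolev Ω 1 ↔ ∀ i, ∃ g : L2 Ω, HasWeakDeriv (Pi.single i 1) u g := by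
  refine ⟨fun h i => h _ (sum_single_one i).le, fun h γ hγ => ?_⟩
  rcases Nat.le_one_iff_eq_zero_or_eq_one.1 hγ with h0 | h1
  · have : γ = 0 := funext fun i => Finset.sum_eq_zero_iff.1 h0 i (Finset.mem_univ i)
    exact ⟨u, this ▸ hasWeakDeriv_self u⟩
  · obtain ⟨i, rfl⟩ := exists_eq_single_of_sum_eq_one h1
    exact h i

theorem sobolevNorm_nonneg (k : ℕ) (u : L2 Ω) : 0 ≤ sobolevNorm k u := Real.sqrt_nonneg _

theorem sobolevNorm_one_sq (u : L2 Ω) :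
    sobolevNorm 1 u ^ 2 = ‖u‖ ^ 2 + ∑ i, ‖weakDeriv (Pi.single i 1) u‖ ^ 2 := by
  rw [sobolevNorm, Real.sq_sqrt (by positivity), Finset.sum_range_succ, Finset.sum_range_one,
    Finset.piAntidiag_zero, Finset.sum_singleton, weakDeriv_zero_index, piAntidiag_univ_one,
    Finset.sum_image]
  intro i _ j _ hij
  by_contra hne
  have := congrFun hij i
  simp [hne] at this

theorem norm_le_sobolevNorm_one (u : L2 Ω) : ‖u‖ ≤ sobolevNorm 1 u := by
  refine (abs_le_of_sq_le_sq' ?_ (sobolevNorm_nonneg 1 u)).2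
  rw [sobolevNorm_one_sq]
  exact le_add_of_nonneg_right (by positivity)

/-! ### Products with smooth functions -/

theorem memLp_mul_of_bounded {g : EuclideanSpace ℝ (Fin d) → ℝ}
    (hg : ContinuousOn g (Ω : Set (EuclideanSpace ℝ (Fin d)))) {K : ℝ} (hK : ∀ x ∈ Ω, |g x| ≤ K)
    (w : L2 Ω) :
    MemLp (fun x => w x * g x) 2
      (volume.restrict (Ω : Set (EuclideanSpace ℝ (Fin d)))) := by
  refine (Lp.memLp w).of_le_mul (c := K) ((Lp.aestronglyMeasurable w).mul
    (hg.aestronglyMeasurable Ω.isOpen.measurableSet)) ?_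
  filter_upwards [ae_restrict_mem Ω.isOpen.measurableSet] with x hx
  rw [norm_mul, mul_comm]
  exact mul_le_mul_of_nonneg_right (hK x hx) (norm_nonneg _)

theorem norm_le_of_ae_eq_mul {g : EuclideanSpace ℝ (Fin d) → ℝ} {K : ℝ}
    (hK : ∀ x ∈ Ω, |g x| ≤ K) {w z : L2 Ω}
    (hz : z =ᵐ[volume.restrict (Ω : Set (EuclideanSpace ℝ (Fin d)))] fun x => w x * g x) :
    ‖z‖ ≤ K * ‖w‖ := by
  refine Lp.norm_le_mul_norm_of_ae_le_mul ?_
  filter_upwards [hz, ae_restrict_mem Ω.isOpen.measurableSet] with x hx hxΩ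
  rw [hx, norm_mul, mul_comm]
  exact mul_le_mul_of_nonneg_right (hK x hxΩ) (norm_nonneg _)

/-- Multiplication by a continuous bounded function, as a linear operator on `L²(Ω)`. -/
noncomputable def mulL2 (g : EuclideanSpace ℝ (Fin d) → ℝ)
    (hg : ContinuousOn g (Ω : Set (EuclideanSpace ℝ (Fin d)))) {K : ℝ}
    (hK : ∀ x ∈ Ω, |g x| ≤ K) : L2 Ω →ₗ[ℝ] L2 Ω where
  toFun w := (memLp_mul_of_bounded hg hK w).toLp _
  map_add' v w := by
    rw [← MemLp.toLp_add]
    refine MemLp.toLp_congr _ _ ?_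
    filter_upwards [Lp.coeFn_add v w] with x hx
    rw [hx, Pi.add_apply, Pi.add_apply, add_mul]
  map_smul' c w := by
    rw [RingHom.id_apply, ← MemLp.toLp_const_smul]
    refine MemLp.toLp_congr _ _ ?_
    filter_upwards [Lp.coeFn_smul c w] with x hx
    rw [hx, Pi.smul_apply, Pi.smul_apply, smul_eq_mul, smul_eq_mul, mul_assoc]

theorem coeFn_mulL2 (g : EuclideanSpace ℝ (Fin d) → ℝ)
    (hg : ContinuousOn g (Ω : Set (EuclideanSpace ℝ (Fin d)))) {K : ℝ}
    (hK : ∀ x ∈ Ω, |g x| ≤ K) (w : L2 Ω) :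
    mulL2 g hg hK w =ᵐ[volume.restrict (Ω : Set (EuclideanSpace ℝ (Fin d)))]
      fun x => w x * g x :=
  (memLp_mul_of_bounded hg hK w).coeFn_toLp

/-- The product space lies in the image of `Vh` under the linear map `mulL2`. -/
theorem finiteDimensional_mulSpace {g : EuclideanSpace ℝ (Fin d) → ℝ}
    (hg : ContinuousOn g (Ω : Set (EuclideanSpace ℝ (Fin d)))) {K : ℝ}
    (hK : ∀ x ∈ Ω, |g x| ≤ K) (Vh : Submodule ℝ (L2 Ω)) [FiniteDimensional ℝ Vh] :
    FiniteDimensional ℝ (mulSpace Vh g) := by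
  have h : mulSpace Vh g ≤ Vh.map (mulL2 g hg hK) := by
    rintro z ⟨v, hv, hz⟩
    exact ⟨v, hv, Lp.ext ((coeFn_mulL2 g hg hK v).trans hz.symm)⟩
  exact Submodule.finiteDimensional_of_le h

/-- Smoothness of `g` on `Ω` alone suffices: near a point outside the support of `φ` the product
vanishes identically. Such products serve as test functions in the product rule. -/
theorem IsTest.mul_left {φ g : EuclideanSpace ℝ (Fin d) → ℝ} (hφ : IsTest Ω φ)
    (hg : ContDiffOn ℝ ∞ g (Ω : Set (EuclideanSpace ℝ (Fin d)))) :
    IsTest Ω (fun x => g x * φ x) := by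
  refine ⟨contDiff_iff_contDiffAt.2 fun x => ?_, hφ.compact.mul_left (f := g),
    tsupport_mul_subset_right.trans hφ.supp⟩
  by_cases hx : x ∈ tsupport φ
  · exact (hg.contDiffAt (Ω.isOpen.mem_nhds (hφ.supp hx))).mul hφ.smooth.contDiffAt
  · have h0 : (fun x => g x * φ x) =ᶠ[nhds x] fun _ => 0 := by
      filter_upwards [notMem_tsupport_iff_eventuallyEq.1 hx] with y hy
      rw [hy, Pi.zero_apply, mul_zero]
    exact contDiffAt_const.congr_of_eventuallyEq h0

theorem pderiv_mul {f g : EuclideanSpace ℝ (Fin d) → ℝ} {x : EuclideanSpace ℝ (Fin d)}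
    (hf : DifferentiableAt ℝ f x) (hg : DifferentiableAt ℝ g x) (i : Fin d) :
    pderiv i (fun y => f y * g y) x = f x * pderiv i g x + g x * pderiv i f x := by
  rw [pderiv, fderiv_fun_mul hf hg]
  simp [pderiv]

/-- The product rule for weak partial derivatives. -/
theorem HasWeakDeriv.mul_smooth {i : Fin d} {g : EuclideanSpace ℝ (Fin d) → ℝ} {w w' z y : L2 Ω}
    (hw : HasWeakDeriv (Pi.single i 1) w w')
    (hg : ContDiffOn ℝ ∞ g (Ω : Set (EuclideanSpace ℝ (Fin d))))
    (hz : z =ᵐ[volume.restrict (Ω : Set (EuclideanSpace ℝ (Fin d)))] fun x => w x * g x)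
    (hy : y =ᵐ[volume.restrict (Ω : Set (EuclideanSpace ℝ (Fin d)))]
      fun x => w' x * g x + w x * EnrichedFEM.pderiv i g x) :
    HasWeakDeriv (Pi.single i 1) z y := by
  intro φ hφ
  -- The weak derivative of `w` is tested against `g φ`; the classical rule for `∂ᵢ(g φ)` then
  -- matches the two integrands almost everywhere.
  have hψ := hφ.mul_left hg
  have h1 := hw _ hψ
  rw [sum_single_one, mderiv_single, pow_one, neg_one_mul] at h1 ⊢
  rw [eq_neg_iff_add_eq_zero] at h1 ⊢
  rw [← integral_add ((hψ.pderiv i).integrable_mul w) (hψ.integrable_mul w')] at h1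
  rw [← integral_add ((hφ.pderiv i).integrable_mul z) (hφ.integrable_mul y), ← h1]
  refine integral_congr_ae ?_
  filter_upwards [hz, hy, ae_restrict_mem Ω.isOpen.measurableSet] with x hzx hyx hx
  rw [hzx, hyx, pderiv_mul ((hg.contDiffAt (Ω.isOpen.mem_nhds hx)).differentiableAt (by simp))
    (hφ.smooth.differentiable (by simp) x) i]
  ring

/-- By the product rule and $(a+b)^2\le2(a^2+b^2)$, each $\|\partial_i(wg)\|^2$ is at most
$2K^2(\|\partial_iw\|^2+\|w\|^2)$. Summing over $i$ and adding $\|wg\|^2\le K^2\|w\|^2$ gives the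
coefficients $2d+1$ and $2$, both at most $2d+2$. -/
theorem mul_smooth_mem_sobolev_one {g : EuclideanSpace ℝ (Fin d) → ℝ}
    (hg : ContDiffOn ℝ ∞ g (Ω : Set (EuclideanSpace ℝ (Fin d)))) {K : ℝ} (hK0 : 0 ≤ K)
    (hK : ∀ x ∈ Ω, |g x| ≤ K) (hK' : ∀ i, ∀ x ∈ Ω, |pderiv i g x| ≤ K) {w z : L2 Ω}
    (hw : w ∈ sobolev Ω 1)
    (hz : z =ᵐ[volume.restrict (Ω : Set (EuclideanSpace ℝ (Fin d)))] fun x => w x * g x) :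
    z ∈ sobolev Ω 1 ∧ sobolevNorm 1 z ≤ √(2 * d + 2) * K * sobolevNorm 1 w := by
  have hpc : ∀ i, ContinuousOn (pderiv i g) (Ω : Set (EuclideanSpace ℝ (Fin d))) := fun i =>
    (hg.continuousOn_fderiv_of_isOpen Ω.isOpen (by simp)).clm_apply continuousOn_const
  have hder : ∀ i, ∃ y : L2 Ω, HasWeakDeriv (Pi.single i 1) z y ∧
      ‖y‖ ≤ K * (‖weakDeriv (Pi.single i 1) w‖ + ‖w‖) := by
    intro i
    obtain ⟨w', hw'⟩ := mem_sobolev_one.1 hw i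
    have h1 := coeFn_mulL2 g hg.continuousOn hK w'
    have h2 := coeFn_mulL2 (pderiv i g) (hpc i) (hK' i) w
    refine ⟨mulL2 g hg.continuousOn hK w' + mulL2 (pderiv i g) (hpc i) (hK' i) w,
      hw'.mul_smooth hg hz ((Lp.coeFn_add _ _).trans (h1.add h2)), ?_⟩
    rw [hw'.weakDeriv_eq, mul_add]
    exact (norm_add_le _ _).trans
      (add_le_add (norm_le_of_ae_eq_mul hK h1) (norm_le_of_ae_eq_mul (hK' i) h2))
  choose y hy hyn using hder
  refine ⟨mem_sobolev_one.2 fun i => ⟨y i, hy i⟩, ?_⟩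
  have hR : 0 ≤ √(2 * (d : ℝ) + 2) * K * sobolevNorm 1 w :=
    mul_nonneg (by positivity) (sobolevNorm_nonneg 1 w)
  refine (abs_le_of_sq_le_sq' ?_ hR).2
  have hi : ∀ i, ‖weakDeriv (Pi.single i 1) z‖ ^ 2 ≤
      2 * K ^ 2 * (‖weakDeriv (Pi.single i 1) w‖ ^ 2 + ‖w‖ ^ 2) := by
    intro i
    rw [(hy i).weakDeriv_eq]
    calc ‖y i‖ ^ 2 ≤ (K * (‖weakDeriv (Pi.single i 1) w‖ + ‖w‖)) ^ 2 := by
          gcongr; exact hyn i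
      _ = K ^ 2 * (‖weakDeriv (Pi.single i 1) w‖ + ‖w‖) ^ 2 := mul_pow _ _ _
      _ ≤ K ^ 2 * (2 * (‖weakDeriv (Pi.single i 1) w‖ ^ 2 + ‖w‖ ^ 2)) := by
          gcongr; exact add_sq_le
      _ = _ := by ring
  have h0 : ‖z‖ ^ 2 ≤ K ^ 2 * ‖w‖ ^ 2 := by
    rw [← mul_pow]
    gcongr
    exact norm_le_of_ae_eq_mul hK hz
  have hsum := Finset.sum_le_sum fun i (_ : i ∈ (Finset.univ : Finset (Fin d))) => hi i
  rw [← Finset.mul_sum, Finset.sum_add_distrib, Finset.sum_const, Finset.card_univ,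
    Fintype.card_fin, nsmul_eq_mul] at hsum
  rw [mul_pow, mul_pow, Real.sq_sqrt (by positivity), sobolevNorm_one_sq, sobolevNorm_one_sq]
  set S := ∑ i, ‖weakDeriv (Pi.single i 1) w‖ ^ 2
  have hS : 0 ≤ S := by positivity
  -- The gap between the two sides is $K^2\|w\|^2+2dK^2S$.
  have hKS : 0 ≤ d * (K ^ 2 * S) := by positivity
  have hKw : 0 ≤ K ^ 2 * ‖w‖ ^ 2 := by positivity
  nlinarith

/-- If test functions `φ` approximate `w`, the test functions `g φ` approximate `w g`, by the
multiplier estimate applied to the difference. -/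
theorem mul_smooth_mem_sobolevZero {g : EuclideanSpace ℝ (Fin d) → ℝ}
    (hg : ContDiffOn ℝ ∞ g (Ω : Set (EuclideanSpace ℝ (Fin d)))) {K : ℝ} (hK0 : 0 ≤ K)
    (hK : ∀ x ∈ Ω, |g x| ≤ K) (hK' : ∀ i, ∀ x ∈ Ω, |pderiv i g x| ≤ K) {w z : L2 Ω}
    (hw : w ∈ sobolevZero Ω)
    (hz : z =ᵐ[volume.restrict (Ω : Set (EuclideanSpace ℝ (Fin d)))] fun x => w x * g x) :
    z ∈ sobolevZero Ω := by
  refine ⟨(mul_smooth_mem_sobolev_one hg hK0 hK hK' hw.1 hz).1, fun ε hε => ?_⟩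
  set R := √(2 * (d : ℝ) + 2) * K
  have hR : 0 ≤ R := by positivity
  -- Dividing by `R + 1` rather than `R` covers `R = 0`.
  obtain ⟨φ, hφ, p, hp, hpφ, hlt⟩ := hw.2 (ε / (R + 1)) (by positivity)
  have hq := coeFn_mulL2 g hg.continuousOn hK p
  refine ⟨_, hφ.mul_left hg, mulL2 g hg.continuousOn hK p,
    (mul_smooth_mem_sobolev_one hg hK0 hK hK' hp hq).1, ?_, ?_⟩
  · filter_upwards [hq, hpφ] with x hx hx'
    rw [hx, hx', mul_comm]
  · have hzq : (z - mulL2 g hg.continuousOn hK p : L2 Ω)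
        =ᵐ[volume.restrict (Ω : Set (EuclideanSpace ℝ (Fin d)))]
          fun x => (w - p : L2 Ω) x * g x := by
      filter_upwards [hz, hq, Lp.coeFn_sub z (mulL2 g hg.continuousOn hK p),
        Lp.coeFn_sub w p] with x h1 h2 h3 h4
      rw [h3, h4, Pi.sub_apply, Pi.sub_apply, h1, h2, sub_mul]
    have hle := (mul_smooth_mem_sobolev_one hg hK0 hK hK' (sub_mem hw.1 hp) hzq).2
    rw [lt_div_iff₀ (by positivity)] at hlt
    have := sobolevNorm_nonneg 1 (w - p)
    linarith

/-! ### The `C^1` norm -/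

theorem c1Norm_nonneg (g : EuclideanSpace ℝ (Fin d) → ℝ) : 0 ≤ c1Norm Ω g :=
  le_max_of_le_left (Real.iSup_nonneg fun _ => abs_nonneg _)

/-- A real supremum bounds its family only when the family is bounded above; compactness of the
closure ensures this. -/
theorem le_iSup_abs_of_continuousOn {f : EuclideanSpace ℝ (Fin d) → ℝ}
    (hΩ : Bornology.IsBounded (Ω : Set (EuclideanSpace ℝ (Fin d))))
    (hf : ContinuousOn f (closure (Ω : Set (EuclideanSpace ℝ (Fin d)))))
    {x : EuclideanSpace ℝ (Fin d)} (hx : x ∈ Ω) : |f x| ≤ ⨆ y : Ω, |f y| := by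
  have hb := (hΩ.isCompact_closure.bddAbove_image hf.abs).mono
    (Set.image_mono (subset_closure (s := (Ω : Set (EuclideanSpace ℝ (Fin d))))))
  refine le_ciSup (f := fun y : Ω => |f y|) (hb.mono ?_) ⟨x, hx⟩
  rintro _ ⟨y, rfl⟩
  exact ⟨y, y.2, rfl⟩

variable {g : EuclideanSpace ℝ (Fin d) → ℝ} {U : Set (EuclideanSpace ℝ (Fin d))}

theorem abs_le_c1Norm (hΩ : Bornology.IsBounded (Ω : Set (EuclideanSpace ℝ (Fin d))))
    (hΩU : closure (Ω : Set (EuclideanSpace ℝ (Fin d))) ⊆ U) (hg : ContDiffOn ℝ ∞ g U) :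
    ∀ x ∈ Ω, |g x| ≤ c1Norm Ω g := fun _ hx =>
  (le_iSup_abs_of_continuousOn hΩ (hg.continuousOn.mono hΩU) hx).trans (le_max_left _ _)

theorem abs_pderiv_le_c1Norm (hΩ : Bornology.IsBounded (Ω : Set (EuclideanSpace ℝ (Fin d))))
    (hU : IsOpen U) (hΩU : closure (Ω : Set (EuclideanSpace ℝ (Fin d))) ⊆ U)
    (hg : ContDiffOn ℝ ∞ g U) (i : Fin d) : ∀ x ∈ Ω, |pderiv i g x| ≤ c1Norm Ω g := fun _ hx => by
  have hc : ContinuousOn (pderiv i g) U :=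
    (hg.continuousOn_fderiv_of_isOpen hU (by simp)).clm_apply continuousOn_const
  exact (le_iSup_abs_of_continuousOn hΩ (hc.mono hΩU) hx).trans
    ((le_ciSup (f := fun i => ⨆ x : Ω, |pderiv i g x|) (Set.finite_range _).bddAbove i).trans
      (le_max_right _ _))

/-- Functions that are smooth up to the boundary are multipliers of `H^1_0(Ω)` and `H^1(Ω)`. -/
theorem mul_smooth_mem (hΩ : Bornology.IsBounded (Ω : Set (EuclideanSpace ℝ (Fin d))))
    (hU : IsOpen U) (hΩU : closure (Ω : Set (EuclideanSpace ℝ (Fin d))) ⊆ U)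
    (hg : ContDiffOn ℝ ∞ g U) {V : Submodule ℝ (L2 Ω)}
    (hV : V = sobolevZero Ω ∨ V = sobolev Ω 1) {w z : L2 Ω} (hw : w ∈ V)
    (hz : z =ᵐ[volume.restrict (Ω : Set (EuclideanSpace ℝ (Fin d)))] fun x => w x * g x) :
    z ∈ V := by
  have h1 := abs_le_c1Norm hΩ hΩU hg
  have h2 := abs_pderiv_le_c1Norm hΩ hU hΩU hg
  have hg' := hg.mono (subset_closure.trans hΩU)
  rcases hV with rfl | rfl
  · exact mul_smooth_mem_sobolevZero hg' (c1Norm_nonneg g) h1 h2 hw hz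
  · exact (mul_smooth_mem_sobolev_one hg' (c1Norm_nonneg g) h1 h2 hw hz).1

end multiplication

/-! ### Galerkin problems: unique solvability and quasi-optimality -/

section galerkin

variable {d : ℕ} {Ω : Opens (EuclideanSpace ℝ (Fin d))} {V : Submodule ℝ (L2 Ω)}
  {B : V →ₗ[ℝ] V →ₗ[ℝ] ℝ} {F : V →ₗ[ℝ] ℝ} {α β : ℝ}

/-- Coercivity forces the $H^1$ norm of `v` to vanish, and that norm dominates the $L^2$ norm. -/
theorem eq_zero_of_coercive (hβ : 0 < β)
    (hB : ∀ v : V, β * sobolevNorm 1 (v : L2 Ω) ^ 2 ≤ |B v v|) {v : V} (hv : B v v = 0) :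
    v = 0 := by
  have h1 := hB v
  rw [hv, abs_zero] at h1
  have h2 : sobolevNorm 1 (v : L2 Ω) ^ 2 ≤ 0 := by
    by_contra! h
    exact absurd h1 (mul_pos hβ h).not_ge
  have h3 : sobolevNorm 1 (v : L2 Ω) = 0 := pow_eq_zero_iff two_ne_zero |>.1
    (le_antisymm h2 (sq_nonneg _))
  have h4 := norm_le_sobolevNorm_one (v : L2 Ω)
  rw [h3, norm_le_zero_iff] at h4
  exact Subtype.ext h4

theorem surjective_of_injective_dual {E : Type*} [AddCommGroup E] [Module ℝ E]
    [FiniteDimensional ℝ E] {T : E →ₗ[ℝ] Module.Dual ℝ E} (hT : Function.Injective T) :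
    Function.Surjective T :=
  (LinearMap.injective_iff_surjective_of_finrank_eq_finrank
    Subspace.dual_finrank_eq.symm).1 hT

/-- The Lax–Milgram lemma in a finite-dimensional subspace. -/
theorem existsUnique_isGalerkinSolution (hβ : 0 < β)
    (hB : ∀ v : V, β * sobolevNorm 1 (v : L2 Ω) ^ 2 ≤ |B v v|) {W : Submodule ℝ (L2 Ω)}
    [FiniteDimensional ℝ W] : ∃! z : V, IsGalerkinSolution B F W z := by
  -- This is `V ∩ W` viewed inside `V`; it embeds in `W`, hence is finite-dimensional.
  let W' : Submodule ℝ V := W.comap V.subtype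
  have : FiniteDimensional ℝ W' := by
    let f : W' →ₗ[ℝ] W := (V.subtype.comp W'.subtype).codRestrict W fun x => x.2
    refine FiniteDimensional.of_injective f fun x y hxy => ?_
    have h : ((f x : W) : L2 Ω) = f y := congrArg _ hxy
    exact Subtype.ext (Subtype.ext h)
  let T : W' →ₗ[ℝ] Module.Dual ℝ W' := B.compl₁₂ W'.subtype W'.subtype
  have hT : Function.Injective T := by
    rw [injective_iff_map_eq_zero]
    intro x hx
    exact Subtype.ext (eq_zero_of_coercive hβ hB (LinearMap.congr_fun hx x))
  obtain ⟨z, hz⟩ := surjective_of_injective_dual hT (F.comp W'.subtype)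
  refine ⟨z, ⟨z.2, fun v hv => LinearMap.congr_fun hz ⟨v, hv⟩⟩, fun y hy => ?_⟩
  refine sub_eq_zero.1 (eq_zero_of_coercive hβ hB ?_)
  have hmem : ((y - z : V) : L2 Ω) ∈ W := sub_mem hy.1 z.2
  have h1 : B z (y - z) = F (y - z) := LinearMap.congr_fun hz ⟨y - z, hmem⟩
  rw [map_sub B, LinearMap.sub_apply, hy.2 _ hmem, h1, sub_self]

/-- Céa's lemma. -/
theorem IsGalerkinSolution.sobolevNorm_sub_le (hα : 0 ≤ α)
    (hBcont : ∀ v w : V, |B v w| ≤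
      α * sobolevNorm 1 (v : L2 Ω) * sobolevNorm 1 (w : L2 Ω))
    (hB : ∀ v : V, β * sobolevNorm 1 (v : L2 Ω) ^ 2 ≤ |B v v|) {u z v : V}
    (hu : ∀ v : V, B u v = F v) {W : Submodule ℝ (L2 Ω)} (hz : IsGalerkinSolution B F W z)
    (hv : (v : L2 Ω) ∈ W) :
    β * sobolevNorm 1 ((u : L2 Ω) - (z : L2 Ω)) ≤
      α * sobolevNorm 1 ((u : L2 Ω) - (v : L2 Ω)) := by
  -- Galerkin orthogonality; it allows `v` to replace `z` in the second argument of `B`.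
  have horth : B (u - z) (v - z) = 0 := by
    rw [map_sub B, LinearMap.sub_apply, hu, hz.2 _ (sub_mem hv hz.1), sub_self]
  have heq : B (u - z) (u - z) = B (u - z) (u - v) := by
    have : u - z = (u - v) + (v - z) := by abel
    nth_rw 2 [this]
    rw [map_add, horth, add_zero]
  have h1 := hB (u - z)
  rw [heq] at h1
  have h2 := h1.trans (hBcont (u - z) (u - v))
  rw [Submodule.coe_sub, Submodule.coe_sub] at h2
  -- One factor of the error norm is cancelled, so a zero error is treated apart.
  rcases (sobolevNorm_nonneg 1 ((u : L2 Ω) - (z : L2 Ω))).eq_or_lt with h0 | h0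
  · rw [← h0, mul_zero]
    exact mul_nonneg hα (sobolevNorm_nonneg 1 _)
  · refine le_of_mul_le_mul_right ?_ h0
    linarith

end galerkin

end EnrichedFEM

/-! ### The error estimate in the multiplicative space -/

theorem theorem4p5 (d : ℕ) (α β CI : ℝ) (hα : 0 < α) (hβ : 0 < β) (hCI : 0 < CI) :
    ∃ C : ℝ, 0 < C ∧
      ∀ (Ω : Opens (EuclideanSpace ℝ (Fin d)))
        (hΩ : Bornology.IsBounded (Ω : Set (EuclideanSpace ℝ (Fin d))))
        -- the Hilbert space of the variational problem, with the norm of `H¹(Ω)`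
        (V : Submodule ℝ (EnrichedFEM.L2 Ω))
        (hV : V = EnrichedFEM.sobolevZero Ω ∨ V = EnrichedFEM.sobolev Ω 1)
        -- a continuous coercive bilinear form and a continuous linear functional on it
        (B : V →ₗ[ℝ] V →ₗ[ℝ] ℝ) (F : V →ₗ[ℝ] ℝ)
        (hBcont : ∀ v w : V, |B v w| ≤
          α * EnrichedFEM.sobolevNorm 1 (v : EnrichedFEM.L2 Ω) *
            EnrichedFEM.sobolevNorm 1 (w : EnrichedFEM.L2 Ω))
        (hBcoer : ∀ v : V,
          β * EnrichedFEM.sobolevNorm 1 (v : EnrichedFEM.L2 Ω) ^ 2 ≤ |B v v|)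
        (hF : ∃ M : ℝ, ∀ v : V, |F v| ≤ M * EnrichedFEM.sobolevNorm 1 (v : EnrichedFEM.L2 Ω))
        -- the exact solution
        (u : V) (hu : ∀ v : V, B u v = F v)
        -- the discrete space, with an interpolation operator of approximation order `m`
        (m : ℕ) (hm : 1 ≤ m) (h : ℝ) (hh : 0 < h)
        (Vh : Submodule ℝ (EnrichedFEM.L2 Ω)) (hVh : Vh ≤ V) (hfin : FiniteDimensional ℝ Vh)
        (Ih : ↥(V ⊓ EnrichedFEM.sobolev Ω m) → Vh)
        (hIh : ∀ v : ↥(V ⊓ EnrichedFEM.sobolev Ω m),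
          EnrichedFEM.sobolevNorm 1 ((v : EnrichedFEM.L2 Ω) - (Ih v : EnrichedFEM.L2 Ω)) ≤
            CI * h ^ (m - 1) * EnrichedFEM.sobolevSeminorm m (v : EnrichedFEM.L2 Ω))
        -- the enriching function, smooth and without zeros on the closure of `Ω`
        (uθ : EuclideanSpace ℝ (Fin d) → ℝ) (U : Set (EuclideanSpace ℝ (Fin d)))
        (hU : IsOpen U) (hΩU : closure (Ω : Set (EuclideanSpace ℝ (Fin d))) ⊆ U)
        (huθ : ContDiffOn ℝ ∞ uθ U)
        (huθ0 : ∀ x ∈ closure (Ω : Set (EuclideanSpace ℝ (Fin d))), uθ x ≠ 0),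
        -- `V_h^*` is conforming, and the Galerkin problem in it is uniquely solvable
        EnrichedFEM.mulSpace Vh uθ ≤ V ∧
        (∃! uh : V, EnrichedFEM.IsGalerkinSolution B F (EnrichedFEM.mulSpace Vh uθ) uh) ∧
        -- the error estimate, whenever `q = u / u_θ` belongs to `H^m(Ω)`
        ∀ q : EnrichedFEM.L2 Ω, q ∈ EnrichedFEM.sobolev Ω m →
          (q =ᵐ[volume.restrict (Ω : Set (EuclideanSpace ℝ (Fin d)))]
            fun x => (u : EnrichedFEM.L2 Ω) x / uθ x) →
          ∀ uh : V, EnrichedFEM.IsGalerkinSolution B F (EnrichedFEM.mulSpace Vh uθ) uh →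
            EnrichedFEM.sobolevNorm 1 ((u : EnrichedFEM.L2 Ω) - (uh : EnrichedFEM.L2 Ω)) ≤
              C * h ^ (m - 1) * EnrichedFEM.c1Norm Ω uθ * EnrichedFEM.sobolevSeminorm m q := by
  refine ⟨α / β * (√(2 * d + 2) * CI), by positivity, ?_⟩
  intro Ω hΩ V hV B F hBcont hBcoer _ u hu m hm h hh Vh hVh _ Ih hIh uθ U hU hΩU huθ huθ0
  have hΩ' : (Ω : Set (EuclideanSpace ℝ (Fin d))) ⊆ U := subset_closure.trans hΩU
  have hb := EnrichedFEM.abs_le_c1Norm hΩ hΩU huθ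
  have hb' := EnrichedFEM.abs_pderiv_le_c1Norm hΩ hU hΩU huθ
  have hconf : EnrichedFEM.mulSpace Vh uθ ≤ V := by
    rintro z ⟨v, hv, hz⟩
    exact EnrichedFEM.mul_smooth_mem hΩ hU hΩU huθ hV (hVh hv) hz
  have := EnrichedFEM.finiteDimensional_mulSpace (huθ.continuousOn.mono hΩ') hb Vh
  refine ⟨hconf, EnrichedFEM.existsUnique_isGalerkinSolution hβ hBcoer, ?_⟩
  intro q hq hqu uh huh
  have hqV : q ∈ V := by
    -- The reciprocal of `uθ` is smooth on the part of `U` where `uθ ≠ 0`, an open set that still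
    -- contains the closure of `Ω`.
    have hU' : IsOpen (U ∩ uθ ⁻¹' {0}ᶜ) :=
      huθ.continuousOn.isOpen_inter_preimage hU isOpen_compl_singleton
    refine EnrichedFEM.mul_smooth_mem (g := fun x => (uθ x)⁻¹) hΩ hU'
      (fun x hx => ⟨hΩU hx, huθ0 x hx⟩)
      ((huθ.mono Set.inter_subset_left).inv fun x hx => hx.2) hV u.2 ?_
    simpa only [div_eq_mul_inv] using hqu
  -- The competitor for Céa's lemma: the interpolant of `q` times `uθ`.
  let v := EnrichedFEM.mulL2 uθ (huθ.continuousOn.mono hΩ') hb (Ih ⟨q, hqV, hq⟩ : EnrichedFEM.L2 Ω)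
  have hv := EnrichedFEM.coeFn_mulL2 uθ (huθ.continuousOn.mono hΩ') hb
    (Ih ⟨q, hqV, hq⟩ : EnrichedFEM.L2 Ω)
  have hvW : v ∈ EnrichedFEM.mulSpace Vh uθ := ⟨_, (Ih ⟨q, hqV, hq⟩).2, hv⟩
  have huv : ((u : EnrichedFEM.L2 Ω) - v : EnrichedFEM.L2 Ω)
      =ᵐ[volume.restrict (Ω : Set (EuclideanSpace ℝ (Fin d)))]
        fun x => (q - (Ih ⟨q, hqV, hq⟩ : EnrichedFEM.L2 Ω) : EnrichedFEM.L2 Ω) x * uθ x := by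
    filter_upwards [hqu, hv, Lp.coeFn_sub (u : EnrichedFEM.L2 Ω) v,
      Lp.coeFn_sub q (Ih ⟨q, hqV, hq⟩ : EnrichedFEM.L2 Ω),
      ae_restrict_mem Ω.isOpen.measurableSet] with x h1 h2 h3 h4 hx
    rw [h3, h4, Pi.sub_apply, Pi.sub_apply, h1, h2, sub_mul,
      div_mul_cancel₀ _ (huθ0 x (subset_closure hx))]
  have hV1 : V ≤ EnrichedFEM.sobolev Ω 1 := by
    rcases hV with rfl | rfl
    · exact fun _ hw => hw.1
    · exact le_rfl
  have hmul := (EnrichedFEM.mul_smooth_mem_sobolev_one (huθ.mono hΩ')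
    (EnrichedFEM.c1Norm_nonneg uθ) hb hb'
    (sub_mem (hV1 hqV) (hV1 (hVh (Ih ⟨q, hqV, hq⟩).2))) huv).2
  have hcea := huh.sobolevNorm_sub_le hα.le hBcont hBcoer hu (v := ⟨v, hconf hvW⟩) hvW
  have hint := hIh ⟨q, hqV, hq⟩
  have hc := EnrichedFEM.c1Norm_nonneg (Ω := Ω) uθ
  calc EnrichedFEM.sobolevNorm 1 ((u : EnrichedFEM.L2 Ω) - (uh : EnrichedFEM.L2 Ω))
      ≤ α / β * EnrichedFEM.sobolevNorm 1 ((u : EnrichedFEM.L2 Ω) - v) := by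
        rw [div_mul_eq_mul_div, le_div_iff₀ hβ, mul_comm]
        exact hcea
    _ ≤ α / β * (√(2 * d + 2) * EnrichedFEM.c1Norm Ω uθ *
          (CI * h ^ (m - 1) * EnrichedFEM.sobolevSeminorm m q)) := by
        refine mul_le_mul_of_nonneg_left (hmul.trans ?_) (by positivity)
        exact mul_le_mul_of_nonneg_left hint (by positivity)
    _ = _ := by ring
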